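/- Let $d$ be a non-negative integer. A set $X\subseteq\mathbb R^d$ is in general position if each set of at most $d+1$ points of $X$ is affinely independent. For finite sets $Y_1,\dots,Y_{d+1}\subset\mathbb R^d$, a $(Y_1,\dots,Y_{d+1})$-simplex is the convex hull of points $y_1,\dots,y_{d+1}$ with $y_i\in Y_i$ for every $i$. Let $S_1,\dots,S_{d+1}$ be pairwise disjoint finite sets of points in $\mathbb R^d$ and let $p\in\mathbb R^d$ be a point belonging to none of the $S_i$, such that $S_1\cup\dots\cup S_{d+1}\cup\{p\}$ is in general position. Then there exist sets $Y_1\subseteq S_1,\dots,Y_{d+1}\subseteq S_{d+1}$ such that 1. $|Y_i|\ge \frac1{2^d}|S_i|$ for every $i\in\{1,\dots,d+1\}$, and 2. the point $p$ either lies in all $(Y_1,\dots,Y_{d+1})$-simplices, or in none of them. -/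

import Mathlib

/-- A set `X` of points of `ℝ^d` is in general position if each set of at most `d + 1` points
of `X` is affinely independent. -/
def InGeneralPosition {d : ℕ} (X : Set (EuclideanSpace ℝ (Fin d))) : Prop :=
  ∀ T : Finset (EuclideanSpace ℝ (Fin d)), (T : Set (EuclideanSpace ℝ (Fin d))) ⊆ X →
    T.card ≤ d + 1 → AffineIndependent ℝ (fun x : T => (x : EuclideanSpace ℝ (Fin d)))

/-- `Δ` is a `(Y₁, …, Y_{d+1})`-simplex: the convex hull of points `y₁, …, y_{d+1}` with
`yᵢ ∈ Yᵢ` for every `i`. -/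
def IsRainbowSimplex {d : ℕ} (Y : Fin (d + 1) → Finset (EuclideanSpace ℝ (Fin d)))
    (Δ : Set (EuclideanSpace ℝ (Fin d))) : Prop :=
  ∃ y : Fin (d + 1) → EuclideanSpace ℝ (Fin d),
    (∀ i, y i ∈ Y i) ∧ Δ = convexHull ℝ (Set.range y)

/-! Call a direction u sparse for S_i if the closed halfspace ⟪u, s - p⟫ ≥ 0 holds less than a
2^(-d) fraction of S_i. If some u ≠ 0 is sparse for no i, the parts of the S_i in its halfspace
serve as Y_i: general position keeps p out of all simplices.

Otherwise the open cones of sparse directions cover all nonzero vectors, and their convex hulls D_i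
miss 0. A sign argument (`exists_vectors_of_cover`) gives vectors u_j, lying in D_i for every i ≠ j,
with a positive combination equal to 0. By conic Carathéodory (`exists_few_generators`) the d
vectors u_j, j ≠ i, lie in the cone of at most 1 + d(d-1) < 2^d sparse directions of S_i. Deleting
the halfspaces of these leaves Y_i with at least |S_i|/2^d points, all satisfying ⟪u_j, y - p⟫ < 0
for j ≠ i. These signs force p into every simplex (`mem_convexHull_of_directions`). -/

/-! ### Signs of linear relations -/

/-- A nonzero continuous functional that is nonpositive on an open set is negative on it. -/
lemma neg_of_nonpos_on_isOpen {E : Type*} [NormedAddCommGroup E] [NormedSpace ℝ E]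
    {D : Set E} (hD : IsOpen D) {z : StrongDual ℝ E} (hz : z ≠ 0) (h : ∀ u ∈ D, z u ≤ 0) :
    ∀ u ∈ D, z u < 0 := by
  intro u hu
  refine lt_of_le_of_ne (h u hu) fun h0 => hz ?_
  have hmax : IsLocalMax z u := by
    filter_upwards [hD.mem_nhds hu] with v hv
    rw [h0]
    exact h v hv
  have := hmax.hasFDerivAt_eq_zero z.hasFDerivAt
  exact this

/-- A real square matrix with negative off-diagonal entries and a positive left kernel vector has
only kernel vectors of strict constant sign. -/
lemma sign_of_kernel {ι : Type*} [Fintype ι] (M : ι → ι → ℝ)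
    (hM : ∀ i j, i ≠ j → M i j < 0) (a : ι → ℝ) (ha : ∀ i, 0 < a i)
    (haM : ∀ j, ∑ i, a i * M i j = 0) (b : ι → ℝ) (hb : b ≠ 0)
    (hMb : ∀ i, ∑ j, M i j * b j = 0) : (∀ j, 0 < b j) ∨ (∀ j, b j < 0) := by
  classical
  have key : ∀ b : ι → ℝ, (∀ i, ∑ j, M i j * b j = 0) → (∃ j, 0 < b j) → ∀ j, 0 < b j := by
    intro b hMb ⟨j₀, hj₀⟩
    by_contra! hne
    obtain ⟨k, hk⟩ := hne
    -- Add the rows in N with weights a. The resulting coefficients are negative off N and, as the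
    -- columns of the full sum vanish, nonnegative on N; so their pairing with b is negative, yet it
    -- must be 0.
    set N : Finset ι := Finset.univ.filter fun i => ¬ 0 < b i with hN
    have hkN : k ∈ N := by simp [hN, hk]
    have h0 : ∑ j, (∑ i ∈ N, a i * M i j) * b j = 0 := by
      have : ∑ i ∈ N, a i * ∑ j, M i j * b j = 0 :=
        Finset.sum_eq_zero fun i _ => by rw [hMb i, mul_zero]
      rw [← this]
      simp_rw [Finset.sum_mul, Finset.mul_sum]
      rw [Finset.sum_comm]
      simp_rw [mul_assoc]
    have hneg : ∀ j, 0 < b j → ∑ i ∈ N, a i * M i j < 0 := by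
      intro j hj
      refine Finset.sum_neg (fun i hi => mul_neg_of_pos_of_neg (ha i) (hM i j ?_)) ⟨k, hkN⟩
      rintro rfl
      simp [hN] at hi
      linarith
    have hpos : ∀ j, ¬ 0 < b j → 0 ≤ ∑ i ∈ N, a i * M i j := by
      intro j hj
      have hs := Finset.sum_filter_add_sum_filter_not Finset.univ (fun i => 0 < b i)
        (fun i => a i * M i j)
      rw [haM j] at hs
      have : ∑ i ∈ Finset.univ.filter (fun i => 0 < b i), a i * M i j ≤ 0 := by
        refine Finset.sum_nonpos fun i hi => (mul_neg_of_pos_of_neg (ha i) (hM i j ?_)).le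
        rintro rfl
        simp at hi
        exact hj hi
      linarith
    have : ∑ j, (∑ i ∈ N, a i * M i j) * b j < 0 := by
      refine Finset.sum_neg' (fun j _ => ?_) ⟨j₀, Finset.mem_univ _,
        mul_neg_of_neg_of_pos (hneg j₀ hj₀) hj₀⟩
      by_cases hj : 0 < b j
      · exact (mul_neg_of_neg_of_pos (hneg j hj) hj).le
      · exact mul_nonpos_of_nonneg_of_nonpos (hpos j hj) (not_lt.mp hj)
    linarith
  obtain ⟨j, hj⟩ := Function.ne_iff.mp hb
  rcases lt_or_gt_of_ne hj with h | h
  · right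
    have := key (-b) (fun i => by simp [hMb i]) ⟨j, by simpa using h⟩
    intro i
    simpa using this i
  · exact Or.inl (key b hMb ⟨j, h⟩)

lemma exists_dependency {ι V : Type*} [Fintype ι] [AddCommGroup V] [Module ℝ V]
    [FiniteDimensional ℝ V] (h : Module.finrank ℝ V < Fintype.card ι) (v : ι → V) :
    ∃ a : ι → ℝ, a ≠ 0 ∧ ∑ i, a i • v i = 0 := by
  have : ¬ LinearIndependent ℝ v := fun hv => absurd hv.fintype_card_le_finrank (not_le.mpr h)
  obtain ⟨g, hg, i, hi⟩ := Fintype.not_linearIndependent_iff.mp this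
  exact ⟨g, fun h => hi (by simp [h]), hg⟩

/-- If `dim E + 1` functionals are never simultaneously nonnegative at a nonzero vector, then
every nontrivial linear relation between them has coefficients of strict constant sign. -/
lemma sign_of_dependency {ι E : Type*} [Fintype ι] [AddCommGroup E] [Module ℝ E]
    [FiniteDimensional ℝ E] (hcard : Fintype.card ι = Module.finrank ℝ E + 1)
    (x : ι → E →ₗ[ℝ] ℝ) (hx : ∀ u ≠ 0, ∃ i, x i u < 0) (a : ι → ℝ) (ha : a ≠ 0)
    (hax : ∀ u, ∑ i, a i * x i u = 0) : (∀ i, 0 < a i) ∨ (∀ i, a i < 0) := by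
  classical
  by_contra! hcon
  obtain ⟨⟨k, hk⟩, l, hl⟩ := hcon
  -- T is injective, so by dimension its range is the whole hyperplane a · z = 0. Unless a has
  -- strict constant sign, this hyperplane contains a nonzero nonnegative vector T u, contrary to
  -- `hx`.
  let T : E →ₗ[ℝ] (ι → ℝ) := LinearMap.pi x
  have hT : LinearMap.ker T = ⊥ := by
    rw [Submodule.eq_bot_iff]
    intro u hu
    by_contra h0
    obtain ⟨i, hi⟩ := hx u h0
    have : T u i = 0 := by rw [LinearMap.mem_ker.mp hu]; rfl
    simp [T] at this
    linarith
  let A : (ι → ℝ) →ₗ[ℝ] ℝ := ∑ i, a i • LinearMap.proj i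
  have hA : ∀ z, A z = ∑ i, a i * z i := fun z => by simp [A]
  have hA0 : A ≠ 0 := by
    obtain ⟨i, hi⟩ := Function.ne_iff.mp ha
    intro h
    have := hA (Pi.single i 1)
    rw [h] at this
    simp [Pi.single_apply] at this
    exact hi this.symm
  have hle : LinearMap.range T ≤ LinearMap.ker A := by
    rintro _ ⟨u, rfl⟩
    rw [LinearMap.mem_ker, hA]
    simpa [T] using hax u
  have heq : LinearMap.range T = LinearMap.ker A := by
    apply Submodule.eq_of_le_of_finrank_eq hle
    have h1 := LinearMap.finrank_range_of_inj (LinearMap.ker_eq_bot.mp hT)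
    have h2 := LinearMap.finrank_range_add_finrank_ker A
    rw [LinearMap.range_eq_top.mpr (LinearMap.surjective hA0)] at h2
    simp at h2
    omega
  have hfin : ∀ z : ι → ℝ, z ≠ 0 → (∀ i, 0 ≤ z i) → A z ≠ 0 := by
    intro z hz hz0 hAz
    have : z ∈ LinearMap.range T := by rw [heq]; exact hAz
    obtain ⟨u, rfl⟩ := this
    have hu : u ≠ 0 := by rintro rfl; simp at hz
    obtain ⟨i, hi⟩ := hx u hu
    have := hz0 i
    simp [T] at this
    linarith
  rcases hk.lt_or_eq with hk' | hk'
  · rcases hl.lt_or_eq with hl' | hl'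
    · have hkl : k ≠ l := by rintro rfl; linarith
      refine hfin (Pi.single k (a l) + Pi.single l (-a k)) ?_ ?_ ?_
      · intro h
        have := congrFun h k
        simp [hkl] at this
        linarith
      · intro i
        simp only [Pi.add_apply, Pi.single_apply]
        split_ifs <;> linarith
      · rw [map_add, hA, hA]
        simp [Pi.single_apply]
        ring
    · refine hfin (Pi.single l 1) (by simp) (fun i => ?_) ?_
      · simp only [Pi.single_apply]; split_ifs <;> norm_num
      · rw [hA]; simp [Pi.single_apply, ← hl']
  · refine hfin (Pi.single k 1) (by simp) (fun i => ?_) ?_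
    · simp only [Pi.single_apply]; split_ifs <;> norm_num
    · rw [hA]; simp [Pi.single_apply, hk']

/-! ### Open convex cones covering the nonzero vectors -/

/-- Let `dim E + 1` open convex cones that miss the origin cover all nonzero vectors. Then any
`dim E` of them have a common vector, and such vectors positively span the origin. -/
lemma exists_vectors_of_cover {ι E : Type*} [Fintype ι] [NormedAddCommGroup E] [NormedSpace ℝ E]
    [FiniteDimensional ℝ E] (hcard : Fintype.card ι = Module.finrank ℝ E + 1)
    (hpos : 0 < Module.finrank ℝ E)
    (D : ι → Set E) (hopen : ∀ i, IsOpen (D i)) (hconv : ∀ i, Convex ℝ (D i))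
    (hcone : ∀ i, ∀ u ∈ D i, ∀ t : ℝ, 0 < t → t • u ∈ D i) (hzero : ∀ i, (0 : E) ∉ D i)
    (hcover : ∀ u ≠ 0, ∃ i, u ∈ D i) :
    ∃ (u : ι → E) (b : ι → ℝ), (∀ i j, i ≠ j → u j ∈ D i) ∧ (∀ j, 0 < b j) ∧
      ∑ j, b j • u j = 0 := by
  classical
  have hsep : ∀ i, ∃ f : StrongDual ℝ E, ∀ u ∈ D i, f u < 0 := fun i => by
    simpa using geometric_hahn_banach_open_point (hconv i) (hopen i) (hzero i)
  choose x hx using hsep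
  -- Stated for every family of separating functionals, because contradictions come from modified
  -- families.
  have hsign : ∀ x : ι → StrongDual ℝ E, (∀ i, ∀ u ∈ D i, x i u < 0) → ∀ a : ι → ℝ, a ≠ 0 →
      (∀ u, ∑ i, a i * x i u = 0) → (∀ i, 0 < a i) ∨ (∀ i, a i < 0) := by
    intro x hx a ha h
    refine sign_of_dependency hcard (fun i => (x i : E →ₗ[ℝ] ℝ)) (fun u hu => ?_) a ha h
    obtain ⟨i, hi⟩ := hcover u hu
    exact ⟨i, hx i u hi⟩
  have hne : ∀ i, (D i).Nonempty := by
    intro i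
    by_contra hemp
    rw [Set.not_nonempty_iff_eq_empty] at hemp
    have : Nontrivial ι := Fintype.one_lt_card_iff_nontrivial.mp (by omega)
    obtain ⟨k, hk⟩ := exists_ne i
    -- Any functional is negative on an empty cone, so x_k may replace x_i; then x_i - x_k = 0 has
    -- mixed signs.
    have := hsign (Function.update x i (x k)) (fun l u hu => by
        by_cases hl : l = i
        · subst hl; simp [hemp] at hu
        · simpa [Function.update_of_ne hl] using hx l u hu)
      (Pi.single i 1 + Pi.single k (-1)) (fun h => by simpa [hk.symm] using congrFun h i)
      (fun u => by
        simp only [Pi.add_apply, add_mul, Finset.sum_add_distrib, Pi.single_apply, ite_mul]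
        simp [Function.update_of_ne hk])
    rcases this with h | h
    · have := h k
      simp [hk] at this
      linarith
    · have := h i
      simp [hk.symm] at this
      linarith
  have hinter : ∀ j, ∃ u, ∀ i, i ≠ j → u ∈ D i := by
    intro j
    by_contra! hcon
    -- With no common vector, P misses the diagonal of E^ι. A separating functional F = ∑ z_i
    -- vanishes on the diagonal, so ∑ z_i = 0 is a relation in which z_j = 0.
    let P : Set (ι → E) := Set.pi {j}ᶜ D
    have hdisj : Disjoint P (LinearMap.range (LinearMap.pi fun _ : ι => (LinearMap.id : E →ₗ[ℝ] E)) :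
        Set (ι → E)) := by
      rw [Set.disjoint_left]
      rintro _ hP ⟨u, rfl⟩
      obtain ⟨i, hi, hu⟩ := hcon u
      exact hu (hP i hi)
    obtain ⟨F, r, hF1, hF2⟩ := geometric_hahn_banach_open (convex_pi fun i _ => hconv i)
      (isOpen_set_pi (Set.toFinite _) fun i _ => hopen i) (Submodule.convex _) hdisj
    have hdiag : ∀ u : E, F (fun _ => u) = 0 := by
      intro u
      by_contra h0
      have := hF2 (fun _ => ((r - 1) / F (fun _ => u)) • u) ⟨((r - 1) / F (fun _ => u)) • u, rfl⟩
      have h2 : F (fun _ : ι => ((r - 1) / F (fun _ => u)) • u) = r - 1 := by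
        have : (fun _ : ι => ((r - 1) / F (fun _ => u)) • u)
          = ((r - 1) / F (fun _ => u)) • (fun _ : ι => u) := rfl
        rw [this, map_smul, smul_eq_mul, div_mul_cancel₀ _ h0]
      linarith
    have hr : r ≤ 0 := by
      have := hF2 (fun _ => 0) ⟨0, rfl⟩
      rwa [hdiag] at this
    have hFP : ∀ a ∈ P, F a < 0 := fun a ha => (hF1 a ha).trans_le hr
    let z : ι → StrongDual ℝ E := fun i => F.comp (ContinuousLinearMap.single ℝ (fun _ => E) i)
    have hz : ∀ v, F v = ∑ i, z i (v i) := by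
      intro v
      conv_lhs => rw [← Finset.univ_sum_single v]
      rw [map_sum]
      rfl
    choose e he using hne
    have hzle : ∀ i v, (i ≠ j → v ∈ D i) → z i v ≤ 0 := by
      intro i v hv
      by_contra! hlt
      set R := ∑ k ∈ Finset.univ.erase i, z k (e k) with hR
      -- Scaling the i-th coordinate by t makes F equal to |R| + 1 + R > 0 at a point of P.
      set t := (|R| + 1) / z i v with ht
      have htpos : 0 < t := by positivity
      have hmem : Function.update e i (t • v) ∈ P := by
        intro k hk
        by_cases hki : k = i
        · subst hki
          simpa using hcone k v (hv hk) t htpos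
        · simpa [Function.update_of_ne hki] using he k
      have h1 := hFP _ hmem
      rw [hz, ← Finset.add_sum_erase _ _ (Finset.mem_univ i)] at h1
      have h2 : ∑ k ∈ Finset.univ.erase i, z k (Function.update e i (t • v) k) = R :=
        Finset.sum_congr rfl fun k hk => by
          rw [Function.update_of_ne (Finset.ne_of_mem_erase hk)]
      rw [h2, Function.update_self, map_smul, smul_eq_mul, ht, div_mul_cancel₀ _ hlt.ne'] at h1
      have := neg_abs_le R
      linarith
    have hzj : z j = 0 := by
      ext v
      have h1 := hzle j v (fun h => absurd rfl h)
      have h2 := hzle j (-v) (fun h => absurd rfl h)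
      rw [map_neg] at h2
      simp only [zero_apply]
      linarith
    have hex : ∃ i, z i ≠ 0 := by
      by_contra! hall
      have := hFP e (fun i _ => he i)
      rw [hz] at this
      simp [hall] at this
    obtain ⟨k, hk⟩ := hex
    -- Vanishing z_i are replaced by x_i with coefficient 0, so the relation has a zero coefficient
    -- at j.
    have := hsign (fun i => if z i = 0 then x i else z i) (fun i u hu => by
        split_ifs with h
        · exact hx i u hu
        · exact neg_of_nonpos_on_isOpen (hopen i) h (fun v hv => hzle i v fun _ => hv) u hu)
      (fun i => if z i = 0 then 0 else 1) (fun h => by simpa [hk] using congrFun h k)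
      (fun u => by
        refine Eq.trans ?_ (hdiag u)
        rw [hz]
        refine Finset.sum_congr rfl fun i _ => ?_
        by_cases h : z i = 0 <;> simp [h])
    rcases this with h | h
    · simpa [hzj] using h j
    · simpa [hzj] using h j
  choose u hu using hinter
  have hxdep : ∃ a : ι → ℝ, (∀ i, 0 < a i) ∧ ∀ v, ∑ i, a i * x i v = 0 := by
    obtain ⟨a, ha, hax⟩ := exists_dependency (V := Module.Dual ℝ E) (ι := ι)
      (by rw [Subspace.dual_finrank_eq]; omega) (fun i => (x i : E →ₗ[ℝ] ℝ))
    have hax' : ∀ v, ∑ i, a i * x i v = 0 := fun v => by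
      simpa using LinearMap.congr_fun hax v
    rcases hsign x hx a ha hax' with h | h
    · exact ⟨a, h, hax'⟩
    · exact ⟨-a, fun i => by simpa using h i, fun v => by simp [hax' v]⟩
  obtain ⟨a, ha, hax⟩ := hxdep
  obtain ⟨b, hb, hbu⟩ := exists_dependency (by omega) u
  have hxb : ∀ i, ∑ j, x i (u j) * b j = 0 := fun i => by
    have := congrArg (x i) hbu
    simpa [mul_comm] using this
  rcases sign_of_kernel (fun i j => x i (u j)) (fun i j hij => hx i _ (hu j i hij)) a ha
    (fun j => hax (u j)) b hb hxb with h | h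
  · exact ⟨u, b, fun i j hij => hu j i hij, h, hbu⟩
  · exact ⟨u, -b, fun i j hij => hu j i hij, fun j => by simpa using h j, by simp [hbu]⟩

/-! ### Cones with few generators -/

/-- Conic Carathéodory theorem with a prescribed extra generator `w₀`: if `C` lies in an open
halfspace, a positive combination of elements of `C` is one of `w₀` and fewer than `dim E`
elements. -/
lemma exists_conic_combination_with {E : Type*} [AddCommGroup E] [Module ℝ E]
    [FiniteDimensional ℝ E] (C : Set E) (f : E →ₗ[ℝ] ℝ) (hf : ∀ w ∈ C, f w < 0) (w₀ : E)
    (hw₀ : w₀ ∈ C) (v : E) (T : Finset E) (hT : ↑T ⊆ C) (c : ℝ) (hc : 0 ≤ c) (t : E → ℝ)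
    (ht : ∀ w ∈ T, 0 ≤ t w) (hv : v = c • w₀ + ∑ w ∈ T, t w • w) :
    ∃ (T : Finset E) (c : ℝ) (t : E → ℝ), ↑T ⊆ C ∧ T.card < max 1 (Module.finrank ℝ E) ∧ 0 ≤ c ∧
      (∀ w ∈ T, 0 ≤ t w) ∧ v = c • w₀ + ∑ w ∈ T, t w • w := by
  classical
  induction hn : T.card using Nat.strong_induction_on generalizing T c t with
  | _ n ih =>
  by_cases hlt : T.card < max 1 (Module.finrank ℝ E)
  · exact ⟨T, c, t, hT, hlt, hc, ht, hv⟩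
  have hdrop : ∀ k ∈ T, ∀ (c' : ℝ) (t' : E → ℝ), 0 ≤ c' → (∀ w ∈ T, 0 ≤ t' w) →
      v = c' • w₀ + ∑ w ∈ T.erase k, t' w • w → ∃ (T : Finset E) (c : ℝ) (t : E → ℝ), ↑T ⊆ C ∧
      T.card < max 1 (Module.finrank ℝ E) ∧ 0 ≤ c ∧
      (∀ w ∈ T, 0 ≤ t w) ∧ v = c • w₀ + ∑ w ∈ T, t w • w := by
    intro k hk c' t' hc' ht' hv'
    exact ih _ (hn ▸ Finset.card_erase_lt_of_mem hk) (T.erase k)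
      (fun w hw => hT (Finset.mem_of_mem_erase hw)) c' hc' t'
      (fun w hw => ht' w (Finset.mem_of_mem_erase hw)) hv' rfl
  by_cases hw : w₀ ∈ T
  · refine hdrop w₀ hw (c + t w₀) t (add_nonneg hc (ht _ hw)) ht ?_
    rw [hv, ← Finset.add_sum_erase _ _ hw, add_smul, add_assoc]
  have hcard : Module.finrank ℝ E < (insert w₀ T).card := by
    rw [Finset.card_insert_of_notMem hw]
    omega
  -- The sign of g is chosen so that subtracting a nonnegative multiple of it cannot lower the
  -- coefficient of w₀; the generator eliminated is then in T.
  have hrel : ∃ g : E → ℝ, g w₀ • w₀ + ∑ w ∈ T, g w • w = 0 ∧ g w₀ ≤ 0 ∧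
      ∃ w ∈ insert w₀ T, g w ≠ 0 := by
    obtain ⟨g, hg, w, hwT, hgw⟩ := Module.exists_nontrivial_relation_of_finrank_lt_card hcard
    rw [Finset.sum_insert hw] at hg
    rcases le_total (g w₀) 0 with h | h
    · exact ⟨g, hg, h, w, hwT, hgw⟩
    · refine ⟨-g, ?_, by simpa using h, w, hwT, by simpa using hgw⟩
      simp only [Pi.neg_apply, neg_smul, Finset.sum_neg_distrib]
      rw [← neg_add, hg, neg_zero]
  obtain ⟨g, hg, hg0, hgne⟩ := hrel
  -- If all coefficients were nonpositive, applying f, negative on all generators, would make them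
  -- all 0.
  have hgpos : (T.filter fun w => 0 < g w).Nonempty := by
    by_contra hemp
    have hle : ∀ w ∈ T, g w ≤ 0 := by
      intro w hwT
      by_contra! h
      exact hemp ⟨w, by simp [hwT, h]⟩
    have h1 : ∑ w ∈ insert w₀ T, g w * f w = 0 := by
      rw [Finset.sum_insert hw]
      simpa using congrArg f hg
    have hneg : ∀ w ∈ insert w₀ T, f w < 0 := by
      intro w hw'
      rcases Finset.mem_insert.mp hw' with rfl | h
      · exact hf _ hw₀
      · exact hf _ (hT h)
    have hle' : ∀ w ∈ insert w₀ T, g w ≤ 0 := by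
      intro w hw'
      rcases Finset.mem_insert.mp hw' with rfl | h
      · exact hg0
      · exact hle w h
    obtain ⟨w, hwT, hgw⟩ := hgne
    have := (Finset.sum_eq_zero_iff_of_nonneg fun w hw' =>
      mul_nonneg_of_nonpos_of_nonpos (hle' w hw') (hneg w hw').le).mp h1 w hwT
    rcases mul_eq_zero.mp this with h | h
    · exact hgw h
    · exact (hneg w hwT).ne h
  obtain ⟨k, hk, hmin⟩ := Finset.exists_min_image _ (fun w => t w / g w) hgpos
  rw [Finset.mem_filter] at hk
  set s := t k / g k with hs
  have hs0 : 0 ≤ s := div_nonneg (ht k hk.1) hk.2.le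
  refine hdrop k hk.1 (c - s * g w₀) (fun w => t w - s * g w) ?_ ?_ ?_
  · nlinarith
  · intro w hwT
    rcases lt_or_ge 0 (g w) with h | h
    · have := hmin w (by simp [hwT, h])
      rw [le_div_iff₀ h] at this
      linarith
    · have := ht w hwT
      nlinarith
  · have hk0 : (t k - s * g k) • k = 0 := by
      rw [hs, div_mul_cancel₀ _ hk.2.ne', sub_self, zero_smul]
    have : ∑ w ∈ T.erase k, (t w - s * g w) • w = ∑ w ∈ T, (t w - s * g w) • w := by
      rw [← Finset.add_sum_erase _ _ hk.1, hk0, zero_add]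
    rw [this, hv]
    have h2 : s • (g w₀ • w₀ + ∑ w ∈ T, g w • w) = 0 := by rw [hg, smul_zero]
    simp only [sub_smul, mul_smul, Finset.sum_sub_distrib, ← Finset.smul_sum]
    rw [smul_add] at h2
    rw [← sub_eq_zero, ← h2]
    abel

open scoped RealInnerProductSpace

lemma neg_of_conic_combination {E : Type*} [AddCommGroup E] [Module ℝ E] (φ : E →ₗ[ℝ] ℝ)
    (w₀ v : E) (T : Finset E) (c : ℝ) (hc : 0 ≤ c) (t : E → ℝ) (ht : ∀ w ∈ T, 0 ≤ t w)
    (hv : v = c • w₀ + ∑ w ∈ T, t w • w) (hv0 : v ≠ 0) (h₀ : φ w₀ < 0)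
    (hT : ∀ w ∈ T, φ w < 0) : φ v < 0 := by
  have hφ : φ v = c * φ w₀ + ∑ w ∈ T, t w * φ w := by simp [hv]
  have h1 : c * φ w₀ ≤ 0 := mul_nonpos_of_nonneg_of_nonpos hc h₀.le
  have h2 : ∀ w ∈ T, t w * φ w ≤ 0 := fun w hw =>
    mul_nonpos_of_nonneg_of_nonpos (ht w hw) (hT w hw).le
  have h3 := Finset.sum_nonpos h2
  refine lt_of_le_of_ne (by linarith) fun h0 => hv0 ?_
  have hc0 : c * φ w₀ = 0 := by linarith
  have hs0 : ∑ w ∈ T, t w * φ w = 0 := by linarith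
  have hc' : c = 0 := (mul_eq_zero.mp hc0).resolve_right h₀.ne
  rw [hv, hc', zero_smul, zero_add]
  refine Finset.sum_eq_zero fun w hw => ?_
  rw [(mul_eq_zero.mp ((Finset.sum_eq_zero_iff_of_nonpos h2).mp hs0 w hw)).resolve_right
    (hT w hw).ne, zero_smul]

/-- Finitely many points of the convex hull of `C` lie in a cone spanned by few elements of `C`. -/
lemma exists_few_generators {κ E : Type*} [Fintype κ] [Nonempty κ] [AddCommGroup E] [Module ℝ E]
    [FiniteDimensional ℝ E] (C : Set E) (f : E →ₗ[ℝ] ℝ) (hf : ∀ w ∈ C, f w < 0)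
    (u : κ → E) (hu : ∀ k, u k ∈ convexHull ℝ C) (hu0 : ∀ k, u k ≠ 0) :
    ∃ W : Finset E, ↑W ⊆ C ∧ W.card ≤ 1 + Fintype.card κ * (max 1 (Module.finrank ℝ E) - 1) ∧
      ∀ φ : E →ₗ[ℝ] ℝ, (∀ w ∈ W, φ w < 0) → ∀ k, φ (u k) < 0 := by
  classical
  -- One w₀ is shared by all the u k, so each needs only dim E - 1 further generators.
  obtain ⟨w₀, hw₀⟩ : C.Nonempty :=
    convexHull_nonempty_iff.mp ⟨_, hu (Classical.arbitrary κ)⟩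
  have hcomb : ∀ k, ∃ (T : Finset E) (c : ℝ) (t : E → ℝ), ↑T ⊆ C ∧
      T.card < max 1 (Module.finrank ℝ E) ∧ 0 ≤ c ∧
      (∀ w ∈ T, 0 ≤ t w) ∧ u k = c • w₀ + ∑ w ∈ T, t w • w := by
    intro k
    have h := hu k
    rw [convexHull_eq_union] at h
    simp only [Set.mem_iUnion] at h
    obtain ⟨T, hT, -, hk⟩ := h
    obtain ⟨t, ht, ht1, hsum⟩ := Finset.mem_convexHull.mp hk
    rw [Finset.centerMass_eq_of_sum_1 _ _ ht1] at hsum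
    exact exists_conic_combination_with C f hf w₀ hw₀ (u k) T hT 0 le_rfl t ht
      (by simpa using hsum.symm)
  choose T c t hT hcard hc ht hk using hcomb
  refine ⟨insert w₀ (Finset.univ.biUnion T), ?_, ?_, ?_⟩
  · intro w hw
    simp only [Finset.coe_insert, Set.mem_insert_iff, Finset.mem_coe, Finset.mem_biUnion] at hw
    rcases hw with rfl | ⟨k, -, h⟩
    · exact hw₀
    · exact hT k h
  · have h1 := Finset.card_insert_le w₀ (Finset.univ.biUnion T)
    have h2 : (Finset.univ.biUnion T).card ≤ Fintype.card κ * (max 1 (Module.finrank ℝ E) - 1) :=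
      Finset.card_biUnion_le_card_mul _ _ _ fun k _ => Nat.le_sub_one_of_lt (hcard k)
    omega
  · intro φ hφ k
    refine neg_of_conic_combination φ w₀ (u k) (T k) (c k) (hc k) (t k) (ht k) (hk k) (hu0 k)
      (hφ _ (Finset.mem_insert_self _ _)) fun w hw => hφ w ?_
    exact Finset.mem_insert_of_mem (Finset.mem_biUnion.mpr ⟨k, Finset.mem_univ _, hw⟩)

/-! ### Sparse directions -/

/-- The points of `S` in the closed halfspace through `p` with inner normal `u`. -/
noncomputable def halfspacePart {E : Type*} [NormedAddCommGroup E] [InnerProductSpace ℝ E]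
    (S : Finset E) (p u : E) : Finset E := by
  classical exact S.filter fun s => 0 ≤ ⟪u, s - p⟫

/-- The directions `u` for which the closed halfspace through `p` with inner normal `u` contains
less than a fraction `1 / m` of the points of `S`. -/
def sparseDirections {E : Type*} [NormedAddCommGroup E] [InnerProductSpace ℝ E]
    (S : Finset E) (p : E) (m : ℕ) : Set E :=
  {u | m * (halfspacePart S p u).card < S.card}

section

variable {E : Type*} [NormedAddCommGroup E] [InnerProductSpace ℝ E]

lemma mem_halfspacePart {S : Finset E} {p u s : E} :
    s ∈ halfspacePart S p u ↔ s ∈ S ∧ 0 ≤ ⟪u, s - p⟫ := by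
  simp [halfspacePart]

/-- Finitely many strict inequalities survive a small perturbation of u, so nearby halfspaces gain
no points of S. -/
lemma isOpen_sparseDirections (S : Finset E) (p : E) (m : ℕ) :
    IsOpen (sparseDirections S p m) := by
  rw [isOpen_iff_mem_nhds]
  intro u hu
  have h : ∀ᶠ v in nhds u, ∀ s ∈ S, ⟪u, s - p⟫ < 0 → ⟪v, s - p⟫ < 0 := by
    rw [Filter.eventually_all_finset]
    intro s _
    by_cases hs : ⟪u, s - p⟫ < 0
    · have hcont : Continuous fun v : E => ⟪v, s - p⟫ := by fun_prop
      filter_upwards [hcont.continuousAt.eventually_lt continuousAt_const hs] with v hv _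
      exact hv
    · exact Filter.Eventually.of_forall fun v h => absurd h hs
  filter_upwards [h] with v hv
  refine lt_of_le_of_lt (Nat.mul_le_mul_left m (Finset.card_le_card fun s hs => ?_)) hu
  rw [mem_halfspacePart] at hs ⊢
  refine ⟨hs.1, ?_⟩
  by_contra! hlt
  linarith [hv s hs.1 hlt]

lemma smul_mem_sparseDirections {S : Finset E} {p : E} {m : ℕ} {u : E}
    (hu : u ∈ sparseDirections S p m) {t : ℝ} (ht : 0 < t) :
    t • u ∈ sparseDirections S p m := by
  have : halfspacePart S p (t • u) = halfspacePart S p u := by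
    ext s
    simp [mem_halfspacePart, real_inner_smul_left, ht]
  simpa [sparseDirections, this] using hu

open scoped Pointwise in
lemma smul_mem_convexHull_sparseDirections {S : Finset E} {p : E} {m : ℕ} {u : E}
    (hu : u ∈ convexHull ℝ (sparseDirections S p m)) {t : ℝ} (ht : 0 < t) :
    t • u ∈ convexHull ℝ (sparseDirections S p m) := by
  have h : t • u ∈ t • convexHull ℝ (sparseDirections S p m) := Set.smul_mem_smul_set hu
  rw [← convexHull_smul] at h
  refine convexHull_mono ?_ h
  rintro _ ⟨v, hv, rfl⟩
  exact smul_mem_sparseDirections hv ht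

/-- By Carathéodory, 0 would be a positive combination of at most dim E + 1 sparse directions. Their
closed halfspaces cover S, but each holds less than |S|/m points. -/
lemma zero_notMem_convexHull_sparseDirections [FiniteDimensional ℝ E] (S : Finset E) (p : E)
    (m : ℕ) (hm : Module.finrank ℝ E + 1 ≤ m) :
    (0 : E) ∉ convexHull ℝ (sparseDirections S p m) := by
  classical
  intro h0
  obtain ⟨κ, _, z, w, hz, haff, hw, hw1, hsum⟩ := eq_pos_convex_span_of_mem_convexHull h0
  have : Nonempty κ := by
    by_contra hemp
    rw [not_nonempty_iff] at hemp
    simp at hw1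
  have hcard : Fintype.card κ ≤ Module.finrank ℝ E + 1 :=
    haff.card_le_finrank_succ.trans (Nat.add_le_add_right (Submodule.finrank_le _) 1)
  have hsub : S ⊆ Finset.univ.biUnion fun k => halfspacePart S p (z k) := by
    intro s hs
    by_contra hcon
    have hneg : ∀ k, ⟪z k, s - p⟫ < 0 := by
      intro k
      by_contra! hk
      exact hcon (Finset.mem_biUnion.mpr ⟨k, Finset.mem_univ _, mem_halfspacePart.mpr ⟨hs, hk⟩⟩)
    have h1 : ∑ k, w k * ⟪z k, s - p⟫ = 0 := by
      have := congrArg (fun v => ⟪v, s - p⟫) hsum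
      simpa [sum_inner, real_inner_smul_left] using this
    have h2 : ∑ k, w k * ⟪z k, s - p⟫ < 0 :=
      Finset.sum_neg (fun k _ => mul_neg_of_pos_of_neg (hw k) (hneg k)) Finset.univ_nonempty
    linarith
  have h1 : m * S.card ≤ ∑ k, m * (halfspacePart S p (z k)).card := by
    rw [← Finset.mul_sum]
    exact Nat.mul_le_mul_left m ((Finset.card_le_card hsub).trans Finset.card_biUnion_le)
  have h2 : ∑ k, m * (halfspacePart S p (z k)).card < ∑ _k : κ, S.card :=
    Finset.sum_lt_sum_of_nonempty Finset.univ_nonempty fun k _ => hz ⟨k, rfl⟩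
  rw [Finset.sum_const, Finset.card_univ, smul_eq_mul] at h2
  have h3 : Fintype.card κ * S.card ≤ m * S.card := Nat.mul_le_mul_right _ (hcard.trans hm)
  omega

/-- Few sparse directions leave many points strictly on the negative side of all of them. -/
lemma exists_subset_negative (S : Finset E) (p : E) (m : ℕ) (W : Finset E)
    (hW : ↑W ⊆ sparseDirections S p m) (hm : W.card + 1 ≤ m) :
    ∃ Y ⊆ S, S.card ≤ m * Y.card ∧ ∀ y ∈ Y, ∀ w ∈ W, ⟪w, y - p⟫ < 0 := by
  classical
  refine ⟨S.filter fun s => ∀ w ∈ W, ⟪w, s - p⟫ < 0, Finset.filter_subset _ _, ?_,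
    fun y hy => (Finset.mem_filter.mp hy).2⟩
  set Y := S.filter fun s => ∀ w ∈ W, ⟪w, s - p⟫ < 0 with hY
  have hsub : S ⊆ Y ∪ W.biUnion fun w => halfspacePart S p w := by
    intro s hs
    by_cases h : ∀ w ∈ W, ⟪w, s - p⟫ < 0
    · exact Finset.mem_union_left _ (Finset.mem_filter.mpr ⟨hs, h⟩)
    · push Not at h
      obtain ⟨w, hw, hws⟩ := h
      exact Finset.mem_union_right _
        (Finset.mem_biUnion.mpr ⟨w, hw, mem_halfspacePart.mpr ⟨hs, hws⟩⟩)
  have h1 : S.card ≤ Y.card + ∑ w ∈ W, (halfspacePart S p w).card :=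
    (Finset.card_le_card hsub).trans ((Finset.card_union_le _ _).trans
      (Nat.add_le_add_left Finset.card_biUnion_le _))
  have h2 : m * ∑ w ∈ W, (halfspacePart S p w).card ≤ W.card * S.card := by
    rw [Finset.mul_sum, ← smul_eq_mul (W.card)]
    exact Finset.sum_le_card_nsmul _ _ _ fun w hw => (hW hw).le
  have h3 := Nat.mul_le_mul_left m h1
  have h4 := Nat.mul_le_mul_right S.card hm
  rw [mul_add] at h3
  rw [add_mul, one_mul] at h4
  omega

end

/-- The source of the constant 2^d: 1 + d(d-1) generators, plus one share for the surviving points.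
Equality holds for d = 1, 2, 3. -/
lemma mul_pred_add_two_le_two_pow (d : ℕ) (hd : 0 < d) : d * (d - 1) + 2 ≤ 2 ^ d := by
  induction d, hd using Nat.le_induction with
  | base => norm_num
  | succ d hd ih =>
    have h1 : d < 2 ^ d := Nat.lt_two_pow_self
    obtain ⟨e, rfl⟩ : ∃ e, d = e + 1 := ⟨d - 1, by omega⟩
    simp only [Nat.add_sub_cancel] at ih ⊢
    have h2 : 2 * (e + 1) ≤ 2 ^ (e + 1) := by
      have : e < 2 ^ e := Nat.lt_two_pow_self
      rw [pow_succ]; omega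
    rw [pow_succ 2 (e + 1)]
    nlinarith

/-! ### Position of p relative to a simplex -/

lemma linearIndependent_sub_of_inGeneralPosition {d : ℕ}
    {S : Fin (d + 1) → Finset (EuclideanSpace ℝ (Fin d))} {p : EuclideanSpace ℝ (Fin d)}
    (hdisj : ∀ i j, i ≠ j → Disjoint (S i) (S j)) (hp : ∀ i, p ∉ S i)
    (hgen : InGeneralPosition ((⋃ i, (S i : Set (EuclideanSpace ℝ (Fin d)))) ∪ {p}))
    (y : Fin (d + 1) → EuclideanSpace ℝ (Fin d)) (hy : ∀ i, y i ∈ S i) (j : Fin (d + 1)) :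
    LinearIndependent ℝ fun i : {i // i ≠ j} => y i.1 - p := by
  classical
  let T : Finset (EuclideanSpace ℝ (Fin d)) := insert p ((Finset.univ.erase j).image y)
  have hT : AffineIndependent ℝ (fun x : T => (x : EuclideanSpace ℝ (Fin d))) := by
    refine hgen T ?_ ?_
    · intro x hx
      simp only [T, Finset.coe_insert, Finset.coe_image, Set.mem_insert_iff, Set.mem_image] at hx
      rcases hx with rfl | ⟨i, -, rfl⟩
      · exact Or.inr rfl
      · exact Or.inl (Set.mem_iUnion.mpr ⟨i, hy i⟩)
    · refine (Finset.card_insert_le _ _).trans (Nat.add_le_add_right ?_ 1)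
      refine Finset.card_image_le.trans ?_
      simp
  let q : Option {i // i ≠ j} → T := fun o => o.elim ⟨p, Finset.mem_insert_self _ _⟩ fun i =>
    ⟨y i, Finset.mem_insert_of_mem (Finset.mem_image_of_mem _ (by simp [i.2]))⟩
  have hyp : ∀ i, y i ≠ p := fun i h => hp i (h ▸ hy i)
  have hq : Function.Injective q := by
    rintro (_ | a) (_ | b) h
    · rfl
    · exact absurd (congrArg Subtype.val h).symm (hyp b)
    · exact absurd (congrArg Subtype.val h) (hyp a)
    · have hab : y a = y b := congrArg Subtype.val h
      have : (a : Fin (d + 1)) = b := by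
        by_contra hne
        exact Finset.disjoint_left.mp (hdisj _ _ hne) (hy a) (hab ▸ hy b)
      rw [Subtype.ext this]
  have hlin := (affineIndependent_iff_linearIndependent_vsub ℝ _ none).mp
    (hT.comp_embedding ⟨q, hq⟩)
  exact hlin.comp (fun i : {i // i ≠ j} => (⟨some i, by simp⟩ : {o // o ≠ none}))
    fun a b h => by simpa using h

/-- A closed halfspace bounded by a hyperplane through `p` separates `p` from a simplex in general
position with respect to `p`. -/
lemma notMem_convexHull_of_halfspace {d : ℕ} (p : EuclideanSpace ℝ (Fin d))
    (y : Fin (d + 1) → EuclideanSpace ℝ (Fin d))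
    (hind : ∀ j, LinearIndependent ℝ fun i : {i // i ≠ j} => y i.1 - p)
    (u : EuclideanSpace ℝ (Fin d)) (hu : u ≠ 0) (hyu : ∀ i, 0 ≤ ⟪u, y i - p⟫) :
    p ∉ convexHull ℝ (Set.range y) := by
  classical
  intro hmem
  have hbary : ∃ a : Fin (d + 1) → ℝ, (∀ i, 0 ≤ a i) ∧ ∑ i, a i = 1 ∧ ∑ i, a i • y i = p := by
    let T : (Fin (d + 1) → ℝ) →ₗ[ℝ] EuclideanSpace ℝ (Fin d) := Fintype.linearCombination ℝ y
    have hrange : Set.range y = T '' Set.range fun i j : Fin (d + 1) => if i = j then (1 : ℝ) else 0 := by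
      rw [← Set.range_comp]
      congr 1
      ext1 i
      simp [T, Fintype.linearCombination_apply]
    rw [hrange, ← T.image_convexHull, convexHull_basis_eq_stdSimplex] at hmem
    obtain ⟨a, ⟨ha, ha1⟩, hap⟩ := hmem
    exact ⟨a, ha, ha1, by simpa [T, Fintype.linearCombination_apply] using hap⟩
  obtain ⟨a, ha, ha1, hap⟩ := hbary
  have hrel : ∑ i, a i • (y i - p) = 0 := by
    simp [smul_sub, Finset.sum_sub_distrib, ← Finset.sum_smul, ha1, hap]
  have hinner : ∑ i, a i * ⟪u, y i - p⟫ = 0 := by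
    have := congrArg (fun v => ⟪u, v⟫) hrel
    simpa [inner_sum, real_inner_smul_right] using this
  have hz := (Finset.sum_eq_zero_iff_of_nonneg fun i _ => mul_nonneg (ha i) (hyu i)).mp hinner
  -- If no weight vanishes, u is orthogonal to a basis, hence 0. If a j = 0, independence of the
  -- other vectors kills all weights, which sum to 1.
  by_cases hpos : ∀ i, a i ≠ 0
  · have horth : ∀ i, ⟪u, y i - p⟫ = 0 := fun i =>
      (mul_eq_zero.mp (hz i (Finset.mem_univ i))).resolve_left (hpos i)
    have hspan := (hind 0).span_eq_top_of_card_eq_finrank' (by simp)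
    have hzero : innerₛₗ ℝ u = 0 := LinearMap.ext_on_range hspan fun i => by simpa using horth i
    have := LinearMap.congr_fun hzero u
    simp at this
    exact hu this
  · push Not at hpos
    obtain ⟨j, hj⟩ := hpos
    have hrest : ∑ i : {i // i ≠ j}, a i • (y i - p) = 0 := by
      rw [Fintype.sum_eq_add_sum_subtype_ne _ j, hj, zero_smul, zero_add] at hrel
      exact hrel
    have h0 := Fintype.linearIndependent_iff.mp (hind j) (fun i => a i) hrest
    have : ∑ i, a i = 0 := Finset.sum_eq_zero fun i _ => by
      by_cases hij : i = j
      · rw [hij, hj]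
      · exact h0 ⟨i, hij⟩
    linarith

/-- If directions `u j` that positively span the origin have `⟪u j, y i - p⟫ < 0` for `i ≠ j`, then
`p` lies in the simplex spanned by the `y i`. -/
lemma mem_convexHull_of_directions {d : ℕ} (p : EuclideanSpace ℝ (Fin d))
    (y u : Fin (d + 1) → EuclideanSpace ℝ (Fin d)) (b : Fin (d + 1) → ℝ) (hb : ∀ j, 0 < b j)
    (hbu : ∑ j, b j • u j = 0) (hyu : ∀ i j, i ≠ j → ⟪u j, y i - p⟫ < 0) :
    p ∈ convexHull ℝ (Set.range y) := by
  obtain ⟨a, ha, hay⟩ := exists_dependency (by simp) fun i => y i - p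
  -- The matrix ⟪u j, y i - p⟫ has left kernel vector b and right kernel vector a.
  have hkey : ∃ a : Fin (d + 1) → ℝ, (∀ i, 0 < a i) ∧ ∑ i, a i • (y i - p) = 0 := by
    rcases sign_of_kernel (fun j i => ⟪u j, y i - p⟫) (fun j i hij => hyu i j hij.symm) b hb
      (fun i => by
        have := congrArg (fun v => ⟪v, y i - p⟫) hbu
        simpa [sum_inner, real_inner_smul_left] using this) a ha
      (fun j => by
        have := congrArg (fun v => ⟪u j, v⟫) hay
        simpa [inner_sum, real_inner_smul_right, mul_comm] using this) with h | h
    · exact ⟨a, h, hay⟩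
    · exact ⟨-a, fun i => by simpa using h i, by simp [hay]⟩
  obtain ⟨c, hc, hcy⟩ := hkey
  have hsum : 0 < ∑ i, c i := Finset.sum_pos (fun i _ => hc i) Finset.univ_nonempty
  have hp : p = Finset.univ.centerMass c y := by
    have h : ∑ i, c i • y i = (∑ i, c i) • p := by
      rw [Finset.sum_smul, ← sub_eq_zero, ← Finset.sum_sub_distrib]
      simpa [smul_sub] using hcy
    rw [Finset.centerMass, h, smul_smul, inv_mul_cancel₀ hsum.ne', one_smul]
  rw [hp]
  exact Finset.centerMass_mem_convexHull _ (fun i _ => (hc i).le) hsum fun i _ => ⟨i, rfl⟩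

/-! ### The dichotomy -/

theorem lemma14 (d : ℕ) (S : Fin (d + 1) → Finset (EuclideanSpace ℝ (Fin d)))
    (p : EuclideanSpace ℝ (Fin d))
    (hdisj : ∀ i j, i ≠ j → Disjoint (S i) (S j))
    (hp : ∀ i, p ∉ S i)
    (hgen : InGeneralPosition ((⋃ i, (S i : Set (EuclideanSpace ℝ (Fin d)))) ∪ {p})) :
    ∃ Y : Fin (d + 1) → Finset (EuclideanSpace ℝ (Fin d)),
      (∀ i, Y i ⊆ S i) ∧
      (∀ i, (1 / 2 ^ d : ℝ) * ((S i).card : ℝ) ≤ ((Y i).card : ℝ)) ∧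
      ((∀ Δ, IsRainbowSimplex Y Δ → p ∈ Δ) ∨ (∀ Δ, IsRainbowSimplex Y Δ → p ∉ Δ)) := by
  classical
  have hcast : ∀ Y : Fin (d + 1) → Finset (EuclideanSpace ℝ (Fin d)),
      (∀ i, (S i).card ≤ 2 ^ d * (Y i).card) →
      ∀ i, (1 / 2 ^ d : ℝ) * ((S i).card : ℝ) ≤ ((Y i).card : ℝ) := by
    intro Y hY i
    have : ((S i).card : ℝ) ≤ 2 ^ d * ((Y i).card : ℝ) := by exact_mod_cast hY i
    rw [one_div, inv_mul_le_iff₀ (by positivity)]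
    exact this
  by_cases hemp : ∃ i, S i = ∅
  · obtain ⟨i, hi⟩ := hemp
    refine ⟨S, fun _ => subset_rfl, hcast S fun i => Nat.le_mul_of_pos_left _ (by positivity),
      Or.inl ?_⟩
    rintro Δ ⟨y, hy, -⟩
    have := hy i
    simp [hi] at this
  push Not at hemp
  -- In dimension 0 the only point is p, which S 0 must avoid.
  have hd : 0 < d := by
    rcases Nat.eq_zero_or_pos d with rfl | h
    · obtain ⟨s, hs⟩ := hemp 0
      exact absurd (Subsingleton.elim s p ▸ hs) (hp 0)
    · exact h
  by_cases hcover : ∀ u ≠ 0, ∃ i, u ∈ sparseDirections (S i) p (2 ^ d)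
  · have hzero : ∀ i, (0 : EuclideanSpace ℝ (Fin d)) ∉
        convexHull ℝ (sparseDirections (S i) p (2 ^ d)) := fun i =>
      zero_notMem_convexHull_sparseDirections _ _ _ (by
        rw [finrank_euclideanSpace_fin]
        exact Nat.lt_two_pow_self)
    obtain ⟨u, b, hu, hb, hbu⟩ := exists_vectors_of_cover (by simp) (by simpa using hd)
      (fun i => convexHull ℝ (sparseDirections (S i) p (2 ^ d)))
      (fun i => (isOpen_sparseDirections _ _ _).convexHull) (fun i => convex_convexHull ℝ _)
      (fun i u hu t ht => smul_mem_convexHull_sparseDirections hu ht) hzero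
      (fun u hu => (hcover u hu).imp fun i hi => subset_convexHull ℝ _ hi)
    have hY : ∀ i, ∃ Y ⊆ S i, (S i).card ≤ 2 ^ d * Y.card ∧
        ∀ y ∈ Y, ∀ j, i ≠ j → ⟪u j, y - p⟫ < 0 := by
      intro i
      have : Nontrivial (Fin (d + 1)) := Fin.nontrivial_iff_two_le.mpr (by omega)
      obtain ⟨k, hk⟩ := exists_ne i
      have : Nonempty {j // j ≠ i} := ⟨⟨k, hk⟩⟩
      obtain ⟨f, hf⟩ := geometric_hahn_banach_open_point (convex_convexHull ℝ _)
        (isOpen_sparseDirections (S i) p (2 ^ d)).convexHull (hzero i)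
      rw [map_zero] at hf
      obtain ⟨W, hWC, hWcard, hW⟩ := exists_few_generators (sparseDirections (S i) p (2 ^ d))
        (f : EuclideanSpace ℝ (Fin d) →ₗ[ℝ] ℝ) (fun w hw => hf w (subset_convexHull ℝ _ hw))
        (fun j : {j // j ≠ i} => u j) (fun j => hu i j j.2.symm)
        (fun j h => hzero i (h ▸ hu i j j.2.symm))
      have hWd : W.card + 1 ≤ 2 ^ d := by
        have h1 := mul_pred_add_two_le_two_pow d hd
        have h2 : Fintype.card {j // j ≠ i} = d := by simp
        rw [h2, finrank_euclideanSpace_fin, max_eq_right (by omega : 1 ≤ d)] at hWcard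
        omega
      obtain ⟨Y, hYS, hYcard, hYW⟩ := exists_subset_negative (S i) p (2 ^ d) W hWC hWd
      refine ⟨Y, hYS, hYcard, fun y hy j hij => ?_⟩
      have := hW (innerₛₗ ℝ (y - p)) (fun w hw => by
        rw [innerₛₗ_apply_apply, real_inner_comm]
        exact hYW y hy w hw) ⟨j, hij.symm⟩
      rwa [innerₛₗ_apply_apply, real_inner_comm] at this
    choose Y hYS hYcard hYu using hY
    refine ⟨Y, hYS, hcast Y hYcard, Or.inl ?_⟩
    rintro Δ ⟨y, hy, rfl⟩
    exact mem_convexHull_of_directions p y u b hb hbu fun i j hij => hYu i _ (hy i) j hij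
  · push Not at hcover
    obtain ⟨u, hu, hSu⟩ := hcover
    refine ⟨fun i => halfspacePart (S i) p u, fun i s hs => (mem_halfspacePart.mp hs).1,
      hcast _ fun i => not_lt.mp (hSu i), Or.inr ?_⟩
    rintro Δ ⟨y, hy, rfl⟩
    exact notMem_convexHull_of_halfspace p y
      (linearIndependent_sub_of_inGeneralPosition hdisj hp hgen y
        fun i => (mem_halfspacePart.mp (hy i)).1) u hu fun i => (mem_halfspacePart.mp (hy i)).2
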